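/- For a real matrix $A$ let $\|A\|_{op}$ be its spectral norm, $\|A\|_F$ its Frobenius norm and $\mathrm{srank}(A)=\|A\|_F^2/\|A\|_{op}^2$. For every $c>0$ and every $E>0$ there is a constant $C=C(c,E)>0$ such that the following holds for all $n,q,d,m$, all matrices $X\in\mathbb{R}^{n\times q}$ and $Y\in\mathbb{R}^{n\times d}$ with rows $x_i$ and $y_i$, and all $0<\varepsilon\le E$. Put $\gamma=\|X\|_{op}^2/\|Y\|_{op}^2$ (quotients with denominator $0$, which occur only if $X=0$ or $Y=0$, are read as $0$). Let $(p_i)_{i\in[n]}$ be any probability distribution with $$p_i\;\ge\;\frac14\cdot\frac{\|x_i\|_2^2+\gamma\|y_i\|_2^2}{\|X\|_F^2+\gamma\|Y\|_F^2}\qquad\text{for all } i\in[n],$$ let $\ell_1,\dots,\ell_m\in[n]$ be i.i.d. random indices with distribution $(p_i)$, and let $\Pi\in\mathbb{R}^{m\times n}$ be the random matrix whose $r$-th row is $\frac{1}{\sqrt{m\,p_{\ell_r}}}\,e_{\ell_r}^\top$. If $$m\;\ge\;C\,\varepsilon^{-2}\,\log n\,\bigl(\mathrm{srank}(X)+\mathrm{srank}(Y)\bigr),$$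 then $$\Pr\Bigl[\,\bigl\|X^\top\Pi^\top\Pi Y-X^\top Y\bigr\|_{op}>\varepsilon\,\|X\|_{op}\|Y\|_{op}\Bigr]\;\le\;n^{-c}.$$ -/

import Mathlib

open MeasureTheory ProbabilityTheory

noncomputable section

open scoped Matrix.Norms.L2Operator in
/-- The operator (spectral) norm of a real matrix: its norm as a linear map between Euclidean
spaces. -/
def matOpNorm {k l : ℕ} (A : Matrix (Fin k) (Fin l) ℝ) : ℝ := ‖A‖

open scoped Matrix.Norms.Frobenius in
/-- The Frobenius norm of a real matrix. -/
def matFrobNorm {k l : ℕ} (A : Matrix (Fin k) (Fin l) ℝ) : ℝ := ‖A‖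

/-- The Euclidean norm of the `i`-th row of a real matrix. -/
def rowNorm {k l : ℕ} (A : Matrix (Fin k) (Fin l) ℝ) (i : Fin k) : ℝ := ‖WithLp.toLp 2 (A i)‖

/-- The stable rank `‖A‖_F² / ‖A‖_op²`. -/
def stableRank {k l : ℕ} (A : Matrix (Fin k) (Fin l) ℝ) : ℝ :=
  matFrobNorm A ^ 2 / matOpNorm A ^ 2

/-- The weight `γ = ‖X‖_op² / ‖Y‖_op²`. -/
def ammWeight {n q d : ℕ} (X : Matrix (Fin n) (Fin q) ℝ) (Y : Matrix (Fin n) (Fin d) ℝ) : ℝ :=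
  matOpNorm X ^ 2 / matOpNorm Y ^ 2

/-- The `m × n` sampling matrix of the sample `ℓ`: its `r`-th row is `e_{ℓ r} / √(m p_{ℓ r})`. -/
def samplingMatrix {n m : ℕ} (p : Fin n → ℝ) (ℓ : Fin m → Fin n) : Matrix (Fin m) (Fin n) ℝ :=
  Matrix.of fun r => (1 / √((m : ℝ) * p (ℓ r))) • (Pi.single (ℓ r) (1 : ℝ) : Fin n → ℝ)

end

open Matrix Finset

/-! Rescale so that `X` and `Y` have operator norm 1 and put them side by side, `W = [X Y]`. The
error matrix is then an off-diagonal block of the Gram error `S = WᵀΠᵀΠW - WᵀW`, a centred sum of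
independent rank-one positive semidefinite matrices `A`, so it suffices to bound `‖S‖`.

The even trace moments of `S` are bounded by the method of exchangeable pairs. Resampling one index
turns `S` into `S'` with the same law. Symmetrising expresses `E tr S^(2j+2)` through `tr ((S -
S')(S^(2j+1) - S'^(2j+1)))`, and the mean value inequality `trace_sub_mul_pow_sub_pow_le` bounds
this by `(S - S')²` against even powers. Since `A² ≤ R A`, the square is controlled by first powers
of the summands, which sum to `S + 2WᵀW`; this gives the recursion `sampleMean_trace_pow_succ_le`.
Absorbing the odd moment and using `WᵀW ≤ 4`, `sampleMean_trace_pow_le` solves it. Markov's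
inequality at a moment of order about `2 log n` makes the dimensional factor `n` harmless. -/

/-! ### Scalar power inequalities. -/

theorem pow_mul_pow_add_le (a b : ℝ) (j q : ℕ) (hq : q ≤ 2 * j) :
    a ^ q * b ^ (2 * j - q) + a ^ (2 * j - q) * b ^ q ≤ a ^ (2 * j) + b ^ (2 * j) := by
  obtain ⟨t, ht⟩ := Nat.exists_eq_add_of_le hq
  have e : 2 * j - q = t := by omega
  have ha : a ^ (2 * j) = |a| ^ q * |a| ^ t := by
    rw [← pow_add, ← ht, Even.pow_abs (even_two_mul j)]
  have hb : b ^ (2 * j) = |b| ^ q * |b| ^ t := by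
    rw [← pow_add, ← ht, Even.pow_abs (even_two_mul j)]
  rw [e, ha, hb]
  have h1 : a ^ q * b ^ t ≤ |a| ^ q * |b| ^ t := by
    rw [← abs_pow, ← abs_pow, ← abs_mul]; exact le_abs_self _
  have h2 : a ^ t * b ^ q ≤ |a| ^ t * |b| ^ q := by
    rw [← abs_pow, ← abs_pow, ← abs_mul]; exact le_abs_self _
  have h3 : 0 ≤ (|a| ^ q - |b| ^ q) * (|a| ^ t - |b| ^ t) := by
    rcases le_total |a| |b| with h | h
    · exact mul_nonneg_of_nonpos_of_nonpos
        (sub_nonpos.2 (pow_le_pow_left₀ (abs_nonneg _) h _))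
        (sub_nonpos.2 (pow_le_pow_left₀ (abs_nonneg _) h _))
    · exact mul_nonneg (sub_nonneg.2 (pow_le_pow_left₀ (abs_nonneg _) h _))
        (sub_nonneg.2 (pow_le_pow_left₀ (abs_nonneg _) h _))
  linarith

/-- Factor the difference of powers as `a - b` times a geometric sum, and pair each term of that sum
with its mirror image; each pair is at most `a^(2j) + b^(2j)`. -/
theorem sub_mul_pow_sub_pow_le (a b : ℝ) (j : ℕ) :
    (a - b) * (a ^ (2 * j + 1) - b ^ (2 * j + 1)) ≤
      (2 * j + 1) / 2 * ((a - b) ^ 2 * (a ^ (2 * j) + b ^ (2 * j))) := by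
  have hg := geom_sum₂_mul a b (2 * j + 1)
  set G := ∑ i ∈ range (2 * j + 1), a ^ i * b ^ (2 * j + 1 - 1 - i) with hG
  have hr : G = ∑ i ∈ range (2 * j + 1), a ^ (2 * j - i) * b ^ i := by
    rw [hG, ← sum_range_reflect]
    refine sum_congr rfl fun i hi => ?_
    have := mem_range.1 hi
    congr 2; omega
  have h2 : 2 * G ≤ (2 * j + 1) * (a ^ (2 * j) + b ^ (2 * j)) := by
    calc 2 * G = G + G := two_mul G
      _ = ∑ i ∈ range (2 * j + 1), (a ^ i * b ^ (2 * j - i) + a ^ (2 * j - i) * b ^ i) := by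
        rw [sum_add_distrib, ← hr]; rfl
      _ ≤ ∑ _i ∈ range (2 * j + 1), (a ^ (2 * j) + b ^ (2 * j)) :=
        sum_le_sum fun i hi => pow_mul_pow_add_le a b j i (by have := mem_range.1 hi; omega)
      _ = _ := by rw [sum_const, card_range, nsmul_eq_mul]; push_cast; rfl
  rw [← hg]
  nlinarith [sq_nonneg (a - b), mul_le_mul_of_nonneg_left h2 (sq_nonneg (a - b))]

/-! ### Trace inequalities for symmetric matrices. -/

section Trace

variable {κ : Type*} [Fintype κ] [DecidableEq κ]

/-- Diagonalise `S` and `T` separately; the weights are the squared overlaps of their eigenvectors.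
As they do not depend on the exponents, a scalar inequality in two variables passes to traces
although `S` and `T` need not commute. -/
theorem exists_trace_pow_mul_pow {S T : Matrix κ κ ℝ} (hS : S.IsHermitian) (hT : T.IsHermitian) :
    ∃ (c : κ → κ → ℝ) (a b : κ → ℝ), (∀ i j, 0 ≤ c i j) ∧
      ∀ k l : ℕ, (S ^ k * T ^ l).trace = ∑ i, ∑ j, c i j * (a i ^ k * b j ^ l) := by
  have key : ∀ {S : Matrix κ κ ℝ}, S.IsHermitian →
      ∃ (U : Matrix κ κ ℝ) (a : κ → ℝ), ∀ k : ℕ, S ^ k = U * diagonal (fun i => a i ^ k) * Uᵀ := by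
    intro S hS
    refine ⟨hS.eigenvectorUnitary, hS.eigenvalues, fun k => ?_⟩
    have h := hS.spectral_theorem
    conv_lhs => rw [h]
    rw [← map_pow, Unitary.conjStarAlgAut_apply, diagonal_pow]
    rfl
  obtain ⟨U, a, hU⟩ := key hS
  obtain ⟨V, b, hV⟩ := key hT
  refine ⟨fun i j => (Uᵀ * V) i j ^ 2, a, b, fun i j => sq_nonneg _, fun k l => ?_⟩
  have h : (S ^ k * T ^ l).trace =
      (diagonal (fun i => a i ^ k) * (Uᵀ * V) * (diagonal (fun i => b i ^ l) * (Uᵀ * V)ᵀ)).trace := by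
    rw [hU, hV, transpose_mul, transpose_transpose, Matrix.mul_assoc U, Matrix.mul_assoc U,
      trace_mul_comm U]
    simp only [Matrix.mul_assoc]
  rw [h, trace]
  refine sum_congr rfl fun i _ => ?_
  rw [diag_apply, mul_apply]
  refine sum_congr rfl fun j _ => ?_
  rw [diagonal_mul, diagonal_mul, transpose_apply]
  ring

/-- A mean value inequality for the trace of odd powers. -/
theorem trace_sub_mul_pow_sub_pow_le {S T : Matrix κ κ ℝ} (hS : S.IsHermitian)
    (hT : T.IsHermitian) (j : ℕ) :
    ((S - T) * (S ^ (2 * j + 1) - T ^ (2 * j + 1))).trace ≤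
      (2 * j + 1) / 2 * (((S - T) ^ 2 * S ^ (2 * j)).trace + ((S - T) ^ 2 * T ^ (2 * j)).trace) := by
  obtain ⟨c, a, b, hc, h⟩ := exists_trace_pow_mul_pow hS hT
  -- Cyclicity of the trace brings every term to the form `tr (S^k T^l)`, to which the spectral
  -- expansion applies.
  have e1 : ((S - T) * (S ^ (2 * j + 1) - T ^ (2 * j + 1))).trace =
      (S ^ (2 * j + 2) * T ^ 0).trace - (S ^ (2 * j + 1) * T ^ 1).trace
        - (S ^ 1 * T ^ (2 * j + 1)).trace + (S ^ 0 * T ^ (2 * j + 2)).trace := by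
    rw [trace_mul_comm (S ^ (2 * j + 1))]
    simp only [← trace_add, ← trace_sub]
    congr 1
    simp only [pow_zero, pow_one, mul_one, one_mul, pow_succ' _ (2 * j + 1)]
    noncomm_ring
  have e2 : ((S - T) ^ 2 * S ^ (2 * j)).trace = (S ^ (2 * j + 2) * T ^ 0).trace
      - 2 * (S ^ (2 * j + 1) * T ^ 1).trace + (S ^ (2 * j) * T ^ 2).trace := by
    have : (S - T) ^ 2 * S ^ (2 * j) = S ^ (2 * j + 2) - S * T * S ^ (2 * j)
        - T * S ^ (2 * j + 1) + T ^ 2 * S ^ (2 * j) := by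
      rw [pow_succ' S (2 * j + 1), pow_succ' S (2 * j)]; noncomm_ring
    rw [this, trace_add, trace_sub, trace_sub, trace_mul_cycle, ← pow_succ,
      trace_mul_comm T, trace_mul_comm (T ^ 2)]
    simp only [pow_zero, pow_one, mul_one]
    ring
  have e3 : ((S - T) ^ 2 * T ^ (2 * j)).trace = (S ^ 2 * T ^ (2 * j)).trace
      - 2 * (S ^ 1 * T ^ (2 * j + 1)).trace + (S ^ 0 * T ^ (2 * j + 2)).trace := by
    have : (S - T) ^ 2 * T ^ (2 * j) = S ^ 2 * T ^ (2 * j) - S * T ^ (2 * j + 1)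
        - T * S * T ^ (2 * j) + T ^ (2 * j + 2) := by
      rw [pow_succ' T (2 * j + 1), pow_succ' T (2 * j)]; noncomm_ring
    rw [this, trace_add, trace_sub, trace_sub, trace_mul_cycle T, ← pow_succ,
      trace_mul_comm (T ^ _) S]
    simp only [pow_zero, pow_one, one_mul]
    ring
  rw [e1, e2, e3]
  simp only [h, mul_sum, ← sum_add_distrib, ← sum_sub_distrib]
  refine sum_le_sum fun i _ => sum_le_sum fun k _ => ?_
  have := mul_le_mul_of_nonneg_left (sub_mul_pow_sub_pow_le (a i) (b k) j) (hc i k)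
  convert this using 1 <;> ring

/-- The trace equals that of `S^j P S^j`, a congruence of `P`. -/
theorem trace_mul_pow_two_mul_nonneg {P S : Matrix κ κ ℝ} (hP : P.PosSemidef)
    (hS : S.IsHermitian) (j : ℕ) : 0 ≤ (P * S ^ (2 * j)).trace := by
  have h := (hP.conjTranspose_mul_mul_same (S ^ j)).trace_nonneg
  rwa [(hS.pow j).eq, Matrix.mul_assoc, trace_mul_comm, Matrix.mul_assoc, ← pow_add,
    ← two_mul] at h

/-- An arithmetic-geometric mean inequality, obtained from `tr ((S - β)² S^(2j)) ≥ 0`. -/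
theorem trace_pow_odd_le {S : Matrix κ κ ℝ} (hS : S.IsHermitian) (j : ℕ) {β : ℝ} (hβ : 0 < β) :
    (S ^ (2 * j + 1)).trace ≤
      (S ^ (2 * (j + 1))).trace / (2 * β) + β / 2 * (S ^ (2 * j)).trace := by
  have hQ : ((S - β • (1 : Matrix κ κ ℝ)) ^ 2).PosSemidef := by
    have h1 : (S - β • (1 : Matrix κ κ ℝ)).IsHermitian :=
      hS.sub (by simp [IsHermitian])
    have := posSemidef_conjTranspose_mul_self (S - β • (1 : Matrix κ κ ℝ))
    rwa [h1.eq, ← sq] at this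
  have h := trace_mul_pow_two_mul_nonneg hQ hS j
  have e : (S - β • (1 : Matrix κ κ ℝ)) ^ 2 * S ^ (2 * j) =
      S ^ (2 * (j + 1)) - (2 * β) • S ^ (2 * j + 1) + (β ^ 2) • S ^ (2 * j) := by
    have : S ^ (2 * (j + 1)) = S * (S * S ^ (2 * j)) := by
      rw [← pow_succ', ← pow_succ']; rfl
    rw [this, pow_succ' S (2 * j), sq, sub_mul, mul_sub, mul_sub]
    simp only [smul_mul_assoc, mul_smul_comm, one_mul, mul_one, sub_mul, Matrix.mul_assoc, smul_smul]
    module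
  rw [e, trace_add, trace_sub, trace_smul, trace_smul, smul_eq_mul, smul_eq_mul] at h
  have : (S ^ (2 * j + 1)).trace = (2 * β * (S ^ (2 * j + 1)).trace) / (2 * β) := by
    field_simp
  rw [this, div_add' _ _ _ (by positivity)]
  gcongr
  nlinarith

end Trace

/-! ### Moments of a centred sum by exchangeable pairs. -/

section Sampling

variable {ι : Type*} [Fintype ι] {m : ℕ}

/-- The expectation of `f k` when the `k r`, `r : Fin m`, are independent with distribution `p`. -/
noncomputable def sampleMean (p : ι → ℝ) (f : (Fin m → ι) → ℝ) : ℝ := ∑ k, (∏ r, p (k r)) * f k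

variable {p : ι → ℝ}

theorem sampleMean_add (f g : (Fin m → ι) → ℝ) :
    sampleMean p (fun k => f k + g k) = sampleMean p f + sampleMean p g := by
  simp only [sampleMean, mul_add, sum_add_distrib]

theorem sampleMean_sub (f g : (Fin m → ι) → ℝ) :
    sampleMean p (fun k => f k - g k) = sampleMean p f - sampleMean p g := by
  simp only [sampleMean, mul_sub, sum_sub_distrib]

theorem sampleMean_const_mul (a : ℝ) (f : (Fin m → ι) → ℝ) :
    sampleMean p (fun k => a * f k) = a * sampleMean p f := by
  simp only [sampleMean, mul_sum]
  exact sum_congr rfl fun k _ => by ring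

theorem sampleMean_sum {α : Type*} (s : Finset α) (f : α → (Fin m → ι) → ℝ) :
    sampleMean p (fun k => ∑ a ∈ s, f a k) = ∑ a ∈ s, sampleMean p (f a) := by
  simp only [sampleMean, mul_sum]
  exact sum_comm

theorem sampleMean_mono (hp : ∀ i, 0 ≤ p i) {f g : (Fin m → ι) → ℝ} (h : ∀ k, f k ≤ g k) :
    sampleMean p f ≤ sampleMean p g :=
  sum_le_sum fun k _ => mul_le_mul_of_nonneg_left (h k) (prod_nonneg fun _ _ => hp _)

theorem sampleMean_const (hp : ∑ i, p i = 1) (a : ℝ) :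
    sampleMean p (fun _ : Fin m → ι => a) = a := by
  classical
  have h := prod_univ_sum (fun _ : Fin m => (univ : Finset ι)) (fun _ i => p i)
  rw [Fintype.piFinset_univ] at h
  rw [sampleMean, ← sum_mul, ← h]
  simp [hp]

/-- Exchanging the `r`-th sample for an independent copy does not change expectations. -/
theorem sampleMean_exchange (r : Fin m) (G : (Fin m → ι) → ι → ℝ) :
    sampleMean p (fun k => ∑ i, p i * G k i) =
      sampleMean p (fun k => ∑ i, p i * G (Function.update k r i) (k r)) := by
  classical
  simp only [sampleMean, mul_sum, ← Fintype.sum_prod_type']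
  have hi : Function.Involutive
      (fun x : (Fin m → ι) × ι => (Function.update x.1 r x.2, x.1 r)) := by
    rintro ⟨k, i⟩; simp
  refine Fintype.sum_equiv hi.toPerm _ _ ?_
  rintro ⟨k, i⟩
  have h1 : ∏ s, p (Function.update k r i s) = p i * ∏ s ∈ univ.erase r, p (k s) := by
    rw [← mul_prod_erase univ _ (mem_univ r), Function.update_self]
    congr 1
    exact prod_congr rfl fun s hs => by rw [Function.update_of_ne (ne_of_mem_erase hs)]
  have h2 := mul_prod_erase univ (fun s => p (k s)) (mem_univ r)
  simp only [Function.Involutive.coe_toPerm, Function.update_idem, Function.update_self,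
    Function.update_eq_self, h1, ← h2]
  ring

theorem sampleMean_apply (hp : ∑ i, p i = 1) (r : Fin m) (g : ι → ℝ) :
    sampleMean p (fun k => g (k r)) = ∑ i, p i * g i := by
  have h := sampleMean_exchange (p := p) r (fun _ i => g i)
  simp only [← sum_mul, hp, one_mul] at h
  rw [← h, sampleMean_const hp]

variable {κ : Type*} [Fintype κ] [DecidableEq κ]

/-- The centred sum of the sampled matrices. -/
noncomputable def centredSum (p : ι → ℝ) (A : ι → Matrix κ κ ℝ) (k : Fin m → ι) : Matrix κ κ ℝ :=
  ∑ r, (A (k r) - ∑ i, p i • A i)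

variable {A : ι → Matrix κ κ ℝ}

omit [Fintype κ] [DecidableEq κ] in
theorem isHermitian_sum_smul (hA : ∀ i, (A i).IsHermitian) : (∑ i, p i • A i).IsHermitian := by
  rw [IsHermitian, conjTranspose_sum]
  exact sum_congr rfl fun i _ => by rw [conjTranspose_smul, (hA i).eq]; rfl

omit [Fintype κ] [DecidableEq κ] in
theorem isHermitian_centredSum (hA : ∀ i, (A i).IsHermitian) (k : Fin m → ι) :
    (centredSum p A k).IsHermitian := by
  rw [IsHermitian, centredSum, conjTranspose_sum]
  exact sum_congr rfl fun r _ => ((hA _).sub (isHermitian_sum_smul hA)).eq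

omit [Fintype κ] [DecidableEq κ] in
theorem centredSum_sub_update [DecidableEq ι] (k : Fin m → ι) (r : Fin m) (i : ι) :
    centredSum p A k - centredSum p A (Function.update k r i) = A (k r) - A i := by
  simp only [centredSum, sum_sub_distrib]
  rw [sub_sub_sub_cancel_right, ← add_sum_erase univ (fun s => A (k s)) (mem_univ r),
    ← add_sum_erase univ (fun s => A (Function.update k r i s)) (mem_univ r), Function.update_self]
  have : ∑ s ∈ univ.erase r, A (Function.update k r i s) = ∑ s ∈ univ.erase r, A (k s) :=
    sum_congr rfl fun s hs => by rw [Function.update_of_ne (ne_of_mem_erase hs)]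
  rw [this, add_sub_add_right_eq_sub]

/-- By the parallelogram identity `(B - D)² ≤ 2B² + 2D²` in the Loewner order, and `B² ≤ R B`, `D² ≤
R D`. -/
theorem trace_sq_sub_mul_le {B D S : Matrix κ κ ℝ} {R : ℝ} (hB : B.IsHermitian)
    (hD : D.IsHermitian) (hS : S.IsHermitian) (hB2 : (R • B - B ^ 2).PosSemidef)
    (hD2 : (R • D - D ^ 2).PosSemidef) (j : ℕ) :
    ((B - D) ^ 2 * S ^ (2 * j)).trace ≤
      2 * R * ((B * S ^ (2 * j)).trace + (D * S ^ (2 * j)).trace) := by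
  have h1 := trace_mul_pow_two_mul_nonneg hB2 hS j
  have h2 := trace_mul_pow_two_mul_nonneg hD2 hS j
  have hP : ((B + D) ^ 2).PosSemidef := by
    have := posSemidef_conjTranspose_mul_self (B + D)
    rwa [(hB.add hD).eq, ← sq] at this
  have h3 := trace_mul_pow_two_mul_nonneg hP hS j
  have e : (B - D) ^ 2 * S ^ (2 * j) + (B + D) ^ 2 * S ^ (2 * j) =
      (2 : ℝ) • (B ^ 2 * S ^ (2 * j)) + (2 : ℝ) • (D ^ 2 * S ^ (2 * j)) := by
    rw [two_smul, two_smul]; noncomm_ring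
  have e' := congrArg trace e
  simp only [trace_add, trace_smul, smul_eq_mul, sub_mul, trace_sub, smul_mul_assoc] at *
  linarith

/-- The exchangeable pairs recursion for the even trace moments. -/
theorem sampleMean_trace_pow_succ_le (hp : ∀ i, 0 ≤ p i) (hp1 : ∑ i, p i = 1) {R : ℝ}
    (hA : ∀ i, (A i).IsHermitian) (hA2 : ∀ i, (R • A i - A i ^ 2).PosSemidef) (j : ℕ) :
    sampleMean p (fun k : Fin m → ι => (centredSum p A k ^ (2 * (j + 1))).trace) ≤
      (2 * j + 1) * R * sampleMean p (fun k : Fin m → ι =>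
        (centredSum p A k ^ (2 * j + 1)).trace +
          2 * ((m • ∑ i, p i • A i) * centredSum p A k ^ (2 * j)).trace) := by
  classical
  set S : (Fin m → ι) → Matrix κ κ ℝ := centredSum p A with hS
  have hSH : ∀ k, (S k).IsHermitian := isHermitian_centredSum hA
  set N := ∑ i, p i • A i with hN
  have key : ∀ r : Fin m, sampleMean p (fun k => ((A (k r) - N) * S k ^ (2 * j + 1)).trace) ≤
      (2 * j + 1) * R * sampleMean p (fun k => ((A (k r) + N) * S k ^ (2 * j)).trace) := by
    intro r
    set F : (Fin m → ι) → ι → ℝ := fun k i => ((A (k r) - A i) * S k ^ (2 * j + 1)).trace with hF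
    set F' : (Fin m → ι) → ι → ℝ := fun k i => ((A (k r) - A i) ^ 2 * S k ^ (2 * j)).trace with hF'
    have h1 : ∀ k : Fin m → ι, ((A (k r) - N) * S k ^ (2 * j + 1)).trace = ∑ i, p i * F k i := by
      intro k
      simp only [hF, hN, sub_mul, trace_sub, mul_sub, sum_sub_distrib,
        sum_mul, trace_sum, smul_mul_assoc, trace_smul, smul_eq_mul]
      rw [← sum_mul, hp1, one_mul]
    -- The swap changes the sign of `A (k r) - A i`, which is also `S - S'`; so the two terms
    -- combine into the left side of the mean value inequality.
    have h2 : ∀ k i, F k i + F (Function.update k r i) (k r) ≤ (2 * j + 1) / 2 *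
        (F' k i + F' (Function.update k r i) (k r)) := by
      intro k i
      have h := trace_sub_mul_pow_sub_pow_le (hSH k) (hSH (Function.update k r i)) j
      rw [hS, centredSum_sub_update, ← hS] at h
      simp only [hF, hF', Function.update_self]
      have e1 : (A i - A (k r)) * S (Function.update k r i) ^ (2 * j + 1) =
        -((A (k r) - A i) * S (Function.update k r i) ^ (2 * j + 1)) := by noncomm_ring
      have e2 : (A i - A (k r)) ^ 2 = (A (k r) - A i) ^ 2 := by noncomm_ring
      rw [e1, e2, trace_neg, ← sub_eq_add_neg, ← trace_sub, ← mul_sub]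
      exact h
    have h3 : ∀ k, ∑ i, p i * F' k i ≤ 2 * R * ((A (k r) + N) * S k ^ (2 * j)).trace := by
      intro k
      calc ∑ i, p i * F' k i ≤ ∑ i, p i * (2 * R * ((A (k r) * S k ^ (2 * j)).trace +
            (A i * S k ^ (2 * j)).trace)) :=
          sum_le_sum fun i _ => mul_le_mul_of_nonneg_left
            (trace_sq_sub_mul_le (hA _) (hA i) (hSH k) (hA2 _) (hA2 i) j) (hp i)
        _ = _ := by
          simp only [hN, add_mul, trace_add, sum_mul, trace_sum, smul_mul_assoc, trace_smul,
            smul_eq_mul, mul_add, sum_add_distrib, mul_sum]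
          congr 1
          · rw [← sum_mul, hp1, one_mul]
          · exact sum_congr rfl fun i _ => by ring
    have e1 := sampleMean_exchange (p := p) r F
    have e2 := sampleMean_exchange (p := p) r F'
    have h4 : sampleMean p (fun k => ∑ i, p i * F k i + ∑ i, p i * F (Function.update k r i) (k r)) ≤
        sampleMean p (fun k => (2 * j + 1) / 2 *
          (∑ i, p i * F' k i + ∑ i, p i * F' (Function.update k r i) (k r))) := by
      refine sampleMean_mono hp fun k => ?_
      rw [← sum_add_distrib, ← sum_add_distrib, mul_sum]
      refine sum_le_sum fun i _ => ?_
      have := mul_le_mul_of_nonneg_left (h2 k i) (hp i)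
      linarith
    have h5 := sampleMean_mono (p := p) hp h3
    rw [sampleMean_const_mul] at h5
    rw [sampleMean_add, ← e1, sampleMean_const_mul, sampleMean_add, ← e2] at h4
    simp only [h1]
    have h6 := mul_le_mul_of_nonneg_left h5 (by positivity : (0 : ℝ) ≤ (2 * j + 1) / 2)
    linarith
  have hl : ∀ k : Fin m → ι, (S k ^ (2 * (j + 1))).trace =
      ∑ r, ((A (k r) - N) * S k ^ (2 * j + 1)).trace := by
    intro k
    rw [← trace_sum, ← sum_mul, show 2 * (j + 1) = 2 * j + 1 + 1 by ring, pow_succ' _ (2 * j + 1)]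
    rfl
  have hr : ∀ k : Fin m → ι, (S k ^ (2 * j + 1)).trace + 2 * ((m • N) * S k ^ (2 * j)).trace =
      ∑ r, ((A (k r) + N) * S k ^ (2 * j)).trace := by
    intro k
    have : ∑ r, (A (k r) + N) = S k + (2 : ℝ) • (m • N) := by
      rw [hS, centredSum]
      simp only [sum_add_distrib, sum_sub_distrib, sum_const, card_univ, Fintype.card_fin, two_smul]
      abel
    rw [← trace_sum, ← sum_mul, this, add_mul, trace_add, smul_mul_assoc (2 : ℝ), trace_smul, smul_eq_mul,
      pow_succ']
  simp only [hl, hr, sampleMean_sum, mul_sum]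
  exact sum_le_sum fun r _ => key r

/-- In the recursion, `trace_pow_odd_le` trades the odd moment for the two neighbouring even ones.
With `(2j+1)R ≤ β` the higher one returns with factor at most 1/2 and is absorbed on the left, so
each step costs a factor `β² + 4Lβ`. -/
theorem sampleMean_trace_pow_le (hp : ∀ i, 0 ≤ p i) (hp1 : ∑ i, p i = 1) {R L β : ℝ}
    (hA : ∀ i, (A i).PosSemidef) (hA2 : ∀ i, (R • A i - A i ^ 2).PosSemidef) (hR : 0 ≤ R)
    (hN : (L • 1 - m • ∑ i, p i • A i : Matrix κ κ ℝ).PosSemidef) (hβ : 0 < β) (hL : 0 ≤ L)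
    (j : ℕ) (hj : (2 * j + 1) * R ≤ β) :
    sampleMean p (fun k : Fin m → ι => (centredSum p A k ^ (2 * (j + 1))).trace) ≤
      (β ^ 2 + 4 * L * β) ^ j * (2 * R * (m • ∑ i, p i • A i).trace) := by
  have hAH := fun i => (hA i).isHermitian
  have hSH : ∀ k : Fin m → ι, (centredSum p A k).IsHermitian := isHermitian_centredSum hAH
  induction j with
  | zero =>
    have h := sampleMean_trace_pow_succ_le (m := m) hp hp1 hAH hA2 0
    -- The odd term of the first step vanishes because the sum is centred.
    have h0 : sampleMean p (fun k : Fin m → ι => (centredSum p A k).trace) = 0 := by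
      simp only [centredSum, trace_sum, sampleMean_sum, trace_sub, sampleMean_sub,
        sampleMean_const hp1]
      simp only [sampleMean_apply hp1 _ (fun i => (A i).trace), trace_smul, smul_eq_mul, sub_self,
        sum_const_zero]
    simp only [mul_zero, zero_add, pow_one, pow_zero, mul_one, sampleMean_add, h0,
      sampleMean_const hp1] at h
    refine h.trans_eq ?_
    push_cast
    ring
  | succ j ih =>
    push_cast at hj
    have ih := ih (by nlinarith)
    have h := sampleMean_trace_pow_succ_le (m := m) hp hp1 hAH hA2 (j + 1)
    set T := fun j => sampleMean p (fun k : Fin m → ι => (centredSum p A k ^ (2 * j)).trace) with hT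
    have hT0 : ∀ j, 0 ≤ T j := by
      intro j
      rw [← sampleMean_const (m := m) hp1 0]
      refine sampleMean_mono hp fun k => ?_
      have := trace_mul_pow_two_mul_nonneg PosSemidef.one (hSH k) j
      rwa [one_mul] at this
    have hle : ∀ k : Fin m → ι, (centredSum p A k ^ (2 * (j + 1) + 1)).trace +
          2 * ((m • ∑ i, p i • A i) * centredSum p A k ^ (2 * (j + 1))).trace ≤
        1 / (2 * β) * (centredSum p A k ^ (2 * (j + 1 + 1))).trace +
          (β / 2 + 2 * L) * (centredSum p A k ^ (2 * (j + 1))).trace := by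
      intro k
      have h1 := trace_pow_odd_le (hSH k) (j + 1) hβ
      have h2 := trace_mul_pow_two_mul_nonneg hN (hSH k) (j + 1)
      rw [sub_mul, trace_sub, smul_mul_assoc, one_mul, trace_smul, smul_eq_mul] at h2
      rw [div_eq_inv_mul, ← one_div] at h1
      linarith
    have hm := sampleMean_mono hp hle
    rw [sampleMean_add (f := fun k : Fin m → ι =>
        1 / (2 * β) * (centredSum p A k ^ (2 * (j + 1 + 1))).trace),
      sampleMean_const_mul, sampleMean_const_mul] at hm
    change _ ≤ 1 / (2 * β) * T (j + 1 + 1) + (β / 2 + 2 * L) * T (j + 1) at hm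
    change T (j + 1 + 1) ≤ _ at h
    change T (j + 1) ≤ _ at ih
    change T (j + 1 + 1) ≤ _
    have hc : (0 : ℝ) ≤ (2 * (j + 1 : ℕ) + 1) * R := by positivity
    have hnn : 0 ≤ 1 / (2 * β) * T (j + 1 + 1) + (β / 2 + 2 * L) * T (j + 1) :=
      add_nonneg (mul_nonneg (by positivity) (hT0 _)) (mul_nonneg (by positivity) (hT0 _))
    have h7 : T (j + 1 + 1) ≤ β * (1 / (2 * β) * T (j + 1 + 1) + (β / 2 + 2 * L) * T (j + 1)) :=
      h.trans ((mul_le_mul_of_nonneg_left hm hc).trans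
        (mul_le_mul_of_nonneg_right (by push_cast; exact hj) hnn))
    have h8 : β * (1 / (2 * β) * T (j + 1 + 1)) = T (j + 1 + 1) / 2 := by field_simp
    have h9 : T (j + 1 + 1) ≤ (β ^ 2 + 4 * L * β) * T (j + 1) := by
      rw [mul_add, h8] at h7
      linarith
    refine h9.trans ((mul_le_mul_of_nonneg_left ih (by positivity)).trans_eq ?_)
    ring

end Sampling

/-! ### Spectral norm estimates. -/

section Norms

open scoped Matrix.Norms.L2Operator

variable {κ ν σ : Type*} [Fintype κ] [DecidableEq κ] [Fintype ν] [DecidableEq ν]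
  [Fintype σ] [DecidableEq σ]

/-- The trace of an even power dominates the same power of every eigenvalue. -/
theorem l2_opNorm_le_of_trace_pow_le {S : Matrix κ κ ℝ} (hS : S.IsHermitian) {j : ℕ} (hj : j ≠ 0)
    {ε : ℝ} (hε : 0 ≤ ε) (h : (S ^ (2 * j)).trace ≤ ε ^ (2 * j)) : ‖S‖ ≤ ε := by
  have hs := hS.spectral_theorem
  have htr : (S ^ (2 * j)).trace = ∑ i, hS.eigenvalues i ^ (2 * j) := by
    conv_lhs => rw [hs]
    rw [← map_pow, Unitary.conjStarAlgAut_apply, diagonal_pow, trace_mul_cycle,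
      Unitary.coe_star_mul_self, one_mul, trace_diagonal]
    rfl
  rw [hs, Unitary.conjStarAlgAut_apply, ← Unitary.coe_star, CStarRing.norm_mul_coe_unitary,
    CStarRing.norm_coe_unitary_mul, l2_opNorm_diagonal, pi_norm_le_iff_of_nonneg hε]
  intro i
  refine le_of_pow_le_pow_left₀ (by omega : 2 * j ≠ 0) hε (le_trans ?_ h)
  rw [htr, Real.norm_eq_abs, Even.pow_abs (even_two_mul j)]
  exact single_le_sum (f := fun i => hS.eigenvalues i ^ (2 * j))
    (fun i _ => (even_two_mul j).pow_nonneg _) (mem_univ i)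

theorem l2_opNorm_transpose (B : Matrix ν σ ℝ) : ‖Bᵀ‖ = ‖B‖ := by
  rw [← conjTranspose_eq_transpose_of_trivial, l2_opNorm_conjTranspose]

omit [DecidableEq κ] in
theorem l2_opNorm_le_one_of_transpose_mul_self {Q : Matrix κ ν ℝ} (h : Qᵀ * Q = 1) : ‖Q‖ ≤ 1 := by
  have h1 := l2_opNorm_conjTranspose_mul_self Q
  rw [conjTranspose_eq_transpose_of_trivial, h, ← diagonal_one, l2_opNorm_diagonal] at h1
  have h2 : ‖(fun _ : ν => (1 : ℝ))‖ ≤ 1 :=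
    (pi_norm_le_iff_of_nonneg zero_le_one).2 fun i => by simp
  nlinarith [norm_nonneg Q]

omit [DecidableEq σ] in
theorem l2_opNorm_fromRows_one_zero : ‖(fromRows 1 0 : Matrix (ν ⊕ σ) ν ℝ)‖ ≤ 1 :=
  l2_opNorm_le_one_of_transpose_mul_self (by simp [transpose_fromRows, fromCols_mul_fromRows])

omit [DecidableEq ν] in
theorem l2_opNorm_fromRows_zero_one : ‖(fromRows 0 1 : Matrix (ν ⊕ σ) σ ℝ)‖ ≤ 1 :=
  l2_opNorm_le_one_of_transpose_mul_self (by simp [transpose_fromRows, fromCols_mul_fromRows])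

omit [DecidableEq κ] in
theorem l2_opNorm_fromCols_le (X : Matrix κ ν ℝ) (Y : Matrix κ σ ℝ) :
    ‖fromCols X Y‖ ≤ ‖X‖ + ‖Y‖ := by
  have e : fromCols X Y = X * (fromRows 1 0 : Matrix (ν ⊕ σ) ν ℝ)ᵀ +
      Y * (fromRows 0 1 : Matrix (ν ⊕ σ) σ ℝ)ᵀ := by
    rw [transpose_fromRows, transpose_fromRows, mul_fromCols, mul_fromCols]
    ext i (j | j) <;> simp
  rw [e]
  refine (norm_add_le _ _).trans (add_le_add ?_ ?_)
  · refine (l2_opNorm_mul _ _).trans (mul_le_of_le_one_right (norm_nonneg _) ?_)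
    rw [l2_opNorm_transpose]
    exact l2_opNorm_fromRows_one_zero
  · refine (l2_opNorm_mul _ _).trans (mul_le_of_le_one_right (norm_nonneg _) ?_)
    rw [l2_opNorm_transpose]
    exact l2_opNorm_fromRows_zero_one

omit [DecidableEq ν] in
theorem posSemidef_smul_one_sub_transpose_mul_self {W : Matrix ν κ ℝ} {L : ℝ}
    (hW : ‖W‖ ^ 2 ≤ L) : (L • 1 - Wᵀ * W : Matrix κ κ ℝ).PosSemidef := by
  refine PosSemidef.of_dotProduct_mulVec_nonneg ?_ fun x => ?_
  · rw [IsHermitian, conjTranspose_eq_transpose_of_trivial]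
    simp [transpose_mul]
  · have h := l2_opNorm_mulVec W (WithLp.toLp 2 x)
    have h2 := pow_le_pow_left₀ (norm_nonneg _) h 2
    rw [mul_pow, EuclideanSpace.real_norm_sq_eq, EuclideanSpace.real_norm_sq_eq] at h2
    have e1 : x ⬝ᵥ (Wᵀ * W) *ᵥ x = ∑ i, (W *ᵥ x) i ^ 2 := by
      rw [← mulVec_mulVec, dotProduct_mulVec, vecMul_transpose, dotProduct]
      exact sum_congr rfl fun i _ => (sq _).symm
    have e2 : x ⬝ᵥ x = ∑ i, x i ^ 2 := sum_congr rfl fun i _ => (sq _).symm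
    rw [star_trivial, sub_mulVec, dotProduct_sub, smul_mulVec, one_mulVec, dotProduct_smul, e1, e2,
      smul_eq_mul, sub_nonneg]
    exact h2.trans (mul_le_mul_of_nonneg_right hW (sum_nonneg fun i _ => sq_nonneg _))

end Norms

/-! ### Frobenius and row norms. -/

section FrobeniusNorm

variable {k l : ℕ}

theorem matFrobNorm_sq (A : Matrix (Fin k) (Fin l) ℝ) : matFrobNorm A ^ 2 = ∑ i, ∑ j, A i j ^ 2 := by
  rw [matFrobNorm, frobenius_norm_def, ← Real.rpow_natCast, ← Real.rpow_mul (by positivity)]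
  norm_num

theorem rowNorm_sq (A : Matrix (Fin k) (Fin l) ℝ) (i : Fin k) : rowNorm A i ^ 2 = ∑ j, A i j ^ 2 := by
  rw [rowNorm, EuclideanSpace.real_norm_sq_eq]

theorem matOpNorm_nonneg (A : Matrix (Fin k) (Fin l) ℝ) : 0 ≤ matOpNorm A := by
  open scoped Matrix.Norms.L2Operator in exact norm_nonneg A

theorem rowNorm_le_matOpNorm (A : Matrix (Fin k) (Fin l) ℝ) (i : Fin k) :
    rowNorm A i ≤ matOpNorm A := by
  have h := l2_opNorm_mulVec Aᵀ (EuclideanSpace.single i (1 : ℝ))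
  rw [l2_opNorm_transpose, PiLp.norm_single, norm_one, mul_one] at h
  have e : (EuclideanSpace.equiv (Fin l) ℝ).symm (Aᵀ *ᵥ (EuclideanSpace.single i (1 : ℝ)).ofLp) =
      WithLp.toLp 2 (A i) := by
    ext j
    simp
  rwa [e] at h

theorem matFrobNorm_sq_le (A : Matrix (Fin k) (Fin l) ℝ) :
    matFrobNorm A ^ 2 ≤ k * matOpNorm A ^ 2 := by
  rw [matFrobNorm_sq]
  simp only [← rowNorm_sq]
  calc ∑ i, rowNorm A i ^ 2 ≤ ∑ _i : Fin k, matOpNorm A ^ 2 :=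
        sum_le_sum fun i _ => pow_le_pow_left₀ (norm_nonneg _) (rowNorm_le_matOpNorm A i) 2
    _ = _ := by simp

theorem matOpNorm_smul (a : ℝ) (A : Matrix (Fin k) (Fin l) ℝ) :
    matOpNorm (a • A) = |a| * matOpNorm A := by
  open scoped Matrix.Norms.L2Operator in exact norm_smul a A

theorem matFrobNorm_smul_sq (a : ℝ) (A : Matrix (Fin k) (Fin l) ℝ) :
    matFrobNorm (a • A) ^ 2 = a ^ 2 * matFrobNorm A ^ 2 := by
  simp only [matFrobNorm_sq, Matrix.smul_apply, smul_eq_mul, mul_pow, mul_sum]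

theorem rowNorm_smul_sq (a : ℝ) (A : Matrix (Fin k) (Fin l) ℝ) (i : Fin k) :
    rowNorm (a • A) i ^ 2 = a ^ 2 * rowNorm A i ^ 2 := by
  simp only [rowNorm_sq, Matrix.smul_apply, smul_eq_mul, mul_pow, mul_sum]

theorem matOpNorm_eq_zero {A : Matrix (Fin k) (Fin l) ℝ} : matOpNorm A = 0 ↔ A = 0 := by
  open scoped Matrix.Norms.L2Operator in exact norm_eq_zero

theorem matFrobNorm_pos {A : Matrix (Fin k) (Fin l) ℝ} (hA : A ≠ 0) : 0 < matFrobNorm A := by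
  open scoped Matrix.Norms.Frobenius in exact norm_pos_iff.2 hA

end FrobeniusNorm

/-! ### The rank-one summands of the sampled Gram matrix. -/

section RowSampling

variable {ι κ : Type*} [Fintype ι] [Fintype κ] [DecidableEq κ] {m : ℕ} {p : ι → ℝ}

/-- The contribution of the `i`-th row of `W` to the sampled Gram matrix. -/
noncomputable def sampledGram (m : ℕ) (p : ι → ℝ) (W : Matrix ι κ ℝ) (i : ι) : Matrix κ κ ℝ :=
  (m * p i)⁻¹ • vecMulVec (W i) (W i)

omit [DecidableEq κ] in
theorem posSemidef_vecMulVec_self (w : κ → ℝ) : (vecMulVec w w).PosSemidef := by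
  have := posSemidef_vecMulVec_self_star w
  rwa [star_trivial] at this

omit [Fintype ι] [DecidableEq κ] in
theorem posSemidef_sampledGram (hp : ∀ i, 0 ≤ p i) (W : Matrix ι κ ℝ) (i : ι) :
    (sampledGram m p W i).PosSemidef :=
  (posSemidef_vecMulVec_self (W i)).smul (inv_nonneg.2 (mul_nonneg m.cast_nonneg (hp i)))

omit [Fintype ι] in
-- The square of a rank-one matrix `w wᵀ` is `|w|²` times itself, so this is a scalar comparison,
-- and the sampling bound `hW` cancels `p i`.
theorem posSemidef_smul_sampledGram_sub_sq (hp : ∀ i, 0 ≤ p i) {W : Matrix ι κ ℝ} {B : ℝ}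
    (hB : 0 ≤ B) (hW : ∀ i, W i ⬝ᵥ W i ≤ B * p i) (i : ι) :
    ((B / m) • sampledGram m p W i - sampledGram m p W i ^ 2).PosSemidef := by
  have hm : (0 : ℝ) ≤ m := m.cast_nonneg
  have e : (B / m) • sampledGram m p W i - sampledGram m p W i ^ 2 =
      ((B / m - (m * p i)⁻¹ * (W i ⬝ᵥ W i)) * (m * p i)⁻¹) • vecMulVec (W i) (W i) := by
    rw [sampledGram, sq, smul_mul_smul_comm, vecMulVec_mul_vecMulVec, vecMulVec_smul, smul_smul,
      smul_smul, ← sub_smul]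
    congr 1
    ring
  rw [e]
  refine (posSemidef_vecMulVec_self (W i)).smul
    (mul_nonneg (sub_nonneg.2 ?_) (inv_nonneg.2 (mul_nonneg hm (hp i))))
  rcases (hp i).eq_or_lt with h0 | h0
  · rw [← h0, mul_zero, _root_.inv_zero, zero_mul]
    positivity
  rcases hm.eq_or_lt with h1 | h1
  · simp [← h1]
  · rw [inv_mul_le_iff₀ (by positivity)]
    refine (hW i).trans_eq ?_
    field_simp

omit [DecidableEq κ] in
theorem smul_sum_sampledGram (hm : 0 < m) (hp : ∀ i, 0 ≤ p i) {W : Matrix ι κ ℝ} {B : ℝ}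
    (hW : ∀ i, W i ⬝ᵥ W i ≤ B * p i) : m • ∑ i, p i • sampledGram m p W i = Wᵀ * W := by
  ext a b
  rw [mul_apply, Matrix.smul_apply, Matrix.sum_apply, nsmul_eq_mul, mul_sum]
  refine sum_congr rfl fun i _ => ?_
  simp only [sampledGram, Matrix.smul_apply, smul_eq_mul, vecMulVec_apply, transpose_apply]
  -- An index of probability 0 has a zero row by `hW`, so the default value `0⁻¹ = 0` loses nothing.
  rcases (hp i).eq_or_lt with h0 | h0
  · have h := hW i
    rw [← h0, mul_zero] at h
    have h2 : W i = 0 := dotProduct_self_eq_zero.1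
      (le_antisymm h (sum_nonneg fun j _ => mul_self_nonneg _))
    simp [h2]
  · have : (0 : ℝ) < m := by exact_mod_cast hm
    field_simp

end RowSampling

theorem centredSum_sampledGram {n m : ℕ} {κ : Type*} [Fintype κ] [DecidableEq κ] {p : Fin n → ℝ}
    (hm : 0 < m) (hp : ∀ i, 0 ≤ p i) {W : Matrix (Fin n) κ ℝ} {B : ℝ}
    (hW : ∀ i, W i ⬝ᵥ W i ≤ B * p i) (k : Fin m → Fin n) :
    centredSum p (sampledGram m p W) k =
      Wᵀ * ((samplingMatrix p k)ᵀ * samplingMatrix p k) * W - Wᵀ * W := by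
  rw [centredSum, sum_sub_distrib, sum_const, card_univ, Fintype.card_fin,
    smul_sum_sampledGram hm hp hW]
  congr 1
  have e : Wᵀ * ((samplingMatrix p k)ᵀ * samplingMatrix p k) * W =
      (samplingMatrix p k * W)ᵀ * (samplingMatrix p k * W) := by
    rw [transpose_mul]; simp only [Matrix.mul_assoc]
  rw [e]
  have hr : ∀ r a, (samplingMatrix p k * W) r a = 1 / √(m * p (k r)) * W (k r) a := by
    intro r a
    simp [samplingMatrix, mul_apply, Pi.single_apply]
  ext a b
  rw [mul_apply, Matrix.sum_apply]
  refine sum_congr rfl fun r _ => ?_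
  rw [transpose_apply, hr, hr, sampledGram, Matrix.smul_apply, vecMulVec_apply, smul_eq_mul]
  have h : (1 / √(m * p (k r))) * (1 / √(m * p (k r))) = (m * p (k r))⁻¹ := by
    rw [one_div, ← mul_inv, Real.mul_self_sqrt (mul_nonneg m.cast_nonneg (hp _))]
  rw [← h]
  ring

/-! ### From moments to the tail bound. -/

/-- Markov's inequality, proved by covering the event by the finitely many atoms of the sample;
independence gives the mass of each atom. -/
theorem measureReal_setOf_le_sampleMean {Ω : Type*} [MeasurableSpace Ω] {μ : Measure Ω}
    [IsProbabilityMeasure μ] {n m : ℕ} {p : Fin n → ℝ} (hp : ∀ i, 0 ≤ p i) {ℓ : Fin m → Ω → Fin n}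
    (hind : iIndepFun ℓ μ) (hlaw : ∀ r i, μ.real {ω | ℓ r ω = i} = p i)
    {Q : (Fin m → Fin n) → Prop} {f : (Fin m → Fin n) → ℝ} (hf : ∀ k, 0 ≤ f k)
    (hQ : ∀ k, Q k → 1 ≤ f k) : μ.real {ω | Q fun r => ℓ r ω} ≤ sampleMean p f := by
  classical
  have hsub : {ω | Q fun r => ℓ r ω} ⊆ ⋃ k ∈ univ.filter Q, ⋂ r, (ℓ r) ⁻¹' {k r} := by
    intro ω hω
    simp only [Set.mem_iUnion, mem_filter, mem_univ, true_and]
    exact ⟨fun r => ℓ r ω, hω, by simp⟩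
  have hk : ∀ k : Fin m → Fin n, μ.real (⋂ r, (ℓ r) ⁻¹' {k r}) = ∏ r, p (k r) := by
    intro k
    rw [measureReal_def, hind.meas_iInter fun r => ⟨{k r}, measurableSet_singleton _, rfl⟩,
      ENNReal.toReal_prod]
    exact prod_congr rfl fun r _ => hlaw r (k r)
  have hw : ∀ k : Fin m → Fin n, 0 ≤ ∏ r, p (k r) := fun k => prod_nonneg fun r _ => hp _
  calc μ.real {ω | Q fun r => ℓ r ω}
      ≤ μ.real (⋃ k ∈ univ.filter Q, ⋂ r, (ℓ r) ⁻¹' {k r}) := measureReal_mono hsub (measure_ne_top _ _)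
    _ ≤ ∑ k ∈ univ.filter Q, μ.real (⋂ r, (ℓ r) ⁻¹' {k r}) := measureReal_biUnion_finset_le _ _
    _ ≤ ∑ k ∈ univ.filter Q, (∏ r, p (k r)) * f k := by
      refine sum_le_sum fun k hk' => ?_
      rw [hk]
      exact le_mul_of_one_le_right (hw k) (hQ k (mem_filter.1 hk').2)
    _ ≤ sampleMean p f :=
      sum_le_sum_of_subset_of_nonneg (filter_subset _ _) fun k _ _ => mul_nonneg (hw k) (hf k)

open scoped Matrix.Norms.L2Operator in
/-- Tail bound for row sampling at a fixed even moment. -/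
theorem measureReal_matOpNorm_gram_sub_le {n q d m : ℕ} {X : Matrix (Fin n) (Fin q) ℝ}
    {Y : Matrix (Fin n) (Fin d) ℝ} {p : Fin n → ℝ} {ε s : ℝ} (hX : matOpNorm X ≤ 1)
    (hY : matOpNorm Y ≤ 1) (hp : ∀ i, 0 ≤ p i) (hp1 : ∑ i, p i = 1)
    (hs : matFrobNorm X ^ 2 + matFrobNorm Y ^ 2 = s) (hs0 : 0 < s)
    (hps : ∀ i, rowNorm X i ^ 2 + rowNorm Y i ^ 2 ≤ 4 * s * p i) (hε : 0 < ε) (hm : 0 < m)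
    {Ω : Type*} [MeasurableSpace Ω] {μ : Measure Ω} [IsProbabilityMeasure μ]
    {ℓ : Fin m → Ω → Fin n} (hind : iIndepFun ℓ μ) (hlaw : ∀ r i, μ.real {ω | ℓ r ω = i} = p i)
    (j : ℕ) {β : ℝ} (hβ : β = 2 * (j + 1) * (4 * s / m)) :
    μ.real {ω | ε < matOpNorm (X.transpose * (samplingMatrix p fun r => ℓ r ω).transpose *
        samplingMatrix p (fun r => ℓ r ω) * Y - X.transpose * Y)} ≤
      n * ((β ^ 2 + 16 * β) / ε ^ 2) ^ (j + 1) := by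
  have hm' : (0 : ℝ) < m := by exact_mod_cast hm
  set W : Matrix (Fin n) (Fin q ⊕ Fin d) ℝ := fromCols X Y with hWdef
  have hWrow : ∀ i, W i ⬝ᵥ W i = rowNorm X i ^ 2 + rowNorm Y i ^ 2 := by
    intro i
    rw [rowNorm_sq, rowNorm_sq, dotProduct, Fintype.sum_sum_type]
    simp [hWdef, sq]
  have hW : ∀ i, W i ⬝ᵥ W i ≤ 4 * s * p i := fun i => (hWrow i).trans_le (hps i)
  have hN := smul_sum_sampledGram hm hp hW
  have htr : (Wᵀ * W).trace = s := by
    rw [trace_mul_comm, trace, ← hs, matFrobNorm_sq, matFrobNorm_sq, ← sum_add_distrib]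
    refine sum_congr rfl fun i _ => ?_
    rw [← rowNorm_sq, ← rowNorm_sq, ← hWrow]
    rfl
  -- The source of the factor `n` in the tail bound; the widths `q` and `d` never enter.
  have hsn : s ≤ 2 * n := by
    have h1 := matFrobNorm_sq_le X
    have h2 := matFrobNorm_sq_le Y
    have h3 := pow_le_one₀ (n := 2) (matOpNorm_nonneg X) hX
    have h4 := pow_le_one₀ (n := 2) (matOpNorm_nonneg Y) hY
    nlinarith [(n.cast_nonneg : (0 : ℝ) ≤ n)]
  have hL : ((4 : ℝ) • 1 - m • ∑ i, p i • sampledGram m p W i).PosSemidef := by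
    rw [hN]
    refine posSemidef_smul_one_sub_transpose_mul_self ?_
    have h := (l2_opNorm_fromCols_le X Y).trans (add_le_add hX hY)
    calc ‖W‖ ^ 2 ≤ (1 + 1 : ℝ) ^ 2 := pow_le_pow_left₀ (norm_nonneg _) h 2
      _ = 4 := by norm_num
  have hR0 : 0 < 4 * s / m := by positivity
  have hβ0 : 0 < β := by rw [hβ]; positivity
  have hmom := sampleMean_trace_pow_le (m := m) hp hp1 (posSemidef_sampledGram hp W)
    (posSemidef_smul_sampledGram_sub_sq hp (by positivity) hW) hR0.le hL hβ0 (by norm_num) j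
    (by rw [hβ]; nlinarith)
  rw [hN, htr] at hmom
  have hSH : ∀ k : Fin m → Fin n, (centredSum p (sampledGram m p W) k).IsHermitian :=
    isHermitian_centredSum fun i => (posSemidef_sampledGram hp W i).isHermitian
  have hprob : μ.real {ω | ε < matOpNorm (X.transpose *
        (samplingMatrix p fun r => ℓ r ω).transpose *
        samplingMatrix p (fun r => ℓ r ω) * Y - X.transpose * Y)} ≤
      sampleMean p (fun k : Fin m → Fin n => (ε ^ (2 * (j + 1)))⁻¹ *
        (centredSum p (sampledGram m p W) k ^ (2 * (j + 1))).trace) := by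
    refine measureReal_setOf_le_sampleMean hp hind hlaw (Q := fun k => ε < matOpNorm (X.transpose *
        (samplingMatrix p k).transpose * samplingMatrix p k * Y - X.transpose * Y))
      (fun k => ?_) fun k hk => ?_
    · have := trace_mul_pow_two_mul_nonneg PosSemidef.one (hSH k) (j + 1)
      rw [one_mul] at this
      exact mul_nonneg (by positivity) this
    · rw [← div_eq_inv_mul, one_le_div (by positivity)]
      by_contra hlt
      have hS := l2_opNorm_le_of_trace_pow_le (hSH k) j.succ_ne_zero hε.le (not_le.1 hlt).le
      -- Block inclusions of norm at most 1 that cut the error matrix out of the Gram error.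
      set P : Matrix (Fin q ⊕ Fin d) (Fin q) ℝ := fromRows 1 0 with hP
      set Q : Matrix (Fin q ⊕ Fin d) (Fin d) ℝ := fromRows 0 1 with hQ
      have hWP : W * P = X := by simp [hWdef, hP, fromCols_mul_fromRows]
      have hWQ : W * Q = Y := by simp [hWdef, hQ, fromCols_mul_fromRows]
      have e : X.transpose * (samplingMatrix p k).transpose * samplingMatrix p k * Y -
          X.transpose * Y = Pᵀ * centredSum p (sampledGram m p W) k * Q := by
        rw [centredSum_sampledGram hm hp hW, ← hWP, ← hWQ]
        simp only [transpose_mul, Matrix.mul_sub, Matrix.sub_mul, Matrix.mul_assoc]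
      refine absurd hk (not_lt.2 ?_)
      rw [e]
      calc ‖Pᵀ * centredSum p (sampledGram m p W) k * Q‖
          ≤ ‖Pᵀ * centredSum p (sampledGram m p W) k‖ * ‖Q‖ := l2_opNorm_mul _ _
        _ ≤ ‖Pᵀ * centredSum p (sampledGram m p W) k‖ :=
          mul_le_of_le_one_right (norm_nonneg _) l2_opNorm_fromRows_zero_one
        _ ≤ ‖Pᵀ‖ * ‖centredSum p (sampledGram m p W) k‖ := l2_opNorm_mul _ _
        _ ≤ ‖centredSum p (sampledGram m p W) k‖ :=
          mul_le_of_le_one_left (norm_nonneg _)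
            ((l2_opNorm_transpose P).trans_le l2_opNorm_fromRows_one_zero)
        _ ≤ ε := hS
  refine hprob.trans ?_
  rw [sampleMean_const_mul, ← div_eq_inv_mul, div_pow, ← pow_mul, ← mul_div_assoc]
  refine div_le_div_of_nonneg_right (hmom.trans ?_) (by positivity)
  -- The initial moment is absorbed as one more factor of the recursion, raising the exponent from
  -- `j` to `j + 1`.
  have h1 : 2 * (4 * s / m) * s ≤ n * (β ^ 2 + 4 * 4 * β) := by
    have h2 : 2 * (4 * s / m) ≤ β := by rw [hβ]; nlinarith [(j.cast_nonneg : (0 : ℝ) ≤ j)]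
    calc 2 * (4 * s / m) * s ≤ β * (2 * n) := mul_le_mul h2 hsn hs0.le hβ0.le
      _ ≤ _ := by nlinarith [mul_nonneg (n.cast_nonneg : (0 : ℝ) ≤ n) hβ0.le,
          mul_nonneg (n.cast_nonneg : (0 : ℝ) ≤ n) (sq_nonneg β)]
  calc _ ≤ (β ^ 2 + 4 * 4 * β) ^ j * (n * (β ^ 2 + 4 * 4 * β)) :=
        mul_le_mul_of_nonneg_left h1 (by positivity)
    _ = _ := by ring

/-- The choice of constants for the tail bound. -/
theorem mul_pow_le_rpow_neg {c E ε s : ℝ} {n m : ℕ} (hE : 0 < E) (hε : 0 < ε)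
    (hεE : ε ≤ E) (hs : 0 < s) (hn : 2 ≤ n) (hm : 0 < m)
    (h : (768 + 48 * E) * Real.exp (c + 1) * (ε⁻¹ ^ 2 * Real.log n * s) ≤ m) (hc : 0 < c) {j : ℕ}
    (hj : Real.log n ≤ j + 1) (hj' : j ≤ Real.log n) {β : ℝ}
    (hβ : β = 2 * (j + 1) * (4 * s / m)) :
    n * ((β ^ 2 + 16 * β) / ε ^ 2) ^ (j + 1) ≤ (n : ℝ) ^ (-c) := by
  have hn' : (2 : ℝ) ≤ n := by exact_mod_cast hn
  have hn0 : (0 : ℝ) < n := by linarith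
  have hm' : (0 : ℝ) < m := by exact_mod_cast hm
  have hlog : 1 / 2 ≤ Real.log n :=
    (by linarith [Real.log_two_gt_d9] : 1 / 2 ≤ Real.log 2).trans (Real.log_le_log two_pos hn')
  set θ := Real.exp (-(c + 1)) with hθ
  have hθ0 : 0 < θ := Real.exp_pos _
  have hθ1 : θ ≤ 1 := Real.exp_le_one_iff.2 (by linarith)
  have hβ0 : 0 < β := by rw [hβ]; positivity
  -- Since `log n ≥ 1/2`, `j + 1 ≤ log n + 1 ≤ 3 log n`.
  have h24 : β ≤ 24 * (Real.log n * s / m) := by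
    rw [hβ]
    have : 2 * ((j : ℝ) + 1) * 4 ≤ 24 * Real.log n := by linarith
    calc 2 * ((j : ℝ) + 1) * (4 * s / m) = 2 * ((j : ℝ) + 1) * 4 * (s / m) := by ring
      _ ≤ 24 * Real.log n * (s / m) := mul_le_mul_of_nonneg_right this (by positivity)
      _ = _ := by ring
  have h1 : (768 + 48 * E) * (Real.log n * s / m) ≤ ε ^ 2 * θ := by
    have e : (768 + 48 * E) * Real.exp (c + 1) * (ε⁻¹ ^ 2 * Real.log n * s) =
        (768 + 48 * E) * (Real.log n * s) / (ε ^ 2 * θ) := by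
      rw [hθ, Real.exp_neg]
      field_simp
    rw [e, div_le_iff₀ (by positivity)] at h
    rw [← mul_div_assoc, div_le_iff₀ hm']
    linarith
  set x := Real.log n * s / m with hx
  have hx0 : 0 ≤ x := by positivity
  -- Here `768 = 24 * 32` serves the term linear in `β`, and `48 = 24 * 2` the quadratic one, where
  -- `ε ≤ E` is needed.
  have hb1 : 32 * β ≤ ε ^ 2 * θ := by nlinarith [mul_nonneg hE.le hx0]
  have hb2 : 2 * E * β ≤ ε ^ 2 * θ := by nlinarith [mul_nonneg hE.le hx0]
  have hb3 : 2 * β ≤ ε * θ := by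
    have : 2 * ε * β ≤ ε * (ε * θ) := by nlinarith
    nlinarith
  have hb4 : (β ^ 2 + 16 * β) / ε ^ 2 ≤ θ := by
    rw [div_le_iff₀ (by positivity)]
    have : (2 * β) ^ 2 ≤ (ε * θ) ^ 2 := pow_le_pow_left₀ (by positivity) hb3 2
    have h3 : (ε * θ) ^ 2 ≤ ε ^ 2 * θ := by
      rw [mul_pow, sq θ]
      exact mul_le_mul_of_nonneg_left (mul_le_of_le_one_left hθ0.le hθ1) (sq_nonneg ε)
    nlinarith
  -- As `j + 1 ≥ log n`, the power of `θ` is at most `n^(-c-1)`; the extra 1 pays for the factor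
  -- `n`.
  calc n * ((β ^ 2 + 16 * β) / ε ^ 2) ^ (j + 1) ≤ n * θ ^ (j + 1) := by gcongr
    _ ≤ n * Real.exp (-(c + 1) * Real.log n) := by
      rw [hθ, ← Real.exp_nat_mul]
      refine mul_le_mul_of_nonneg_left (Real.exp_le_exp.2 ?_) hn0.le
      push_cast
      nlinarith
    _ = (n : ℝ) ^ (-c) := by
      rw [Real.rpow_def_of_pos hn0]
      nth_rewrite 1 [← Real.exp_log hn0]
      rw [← Real.exp_add]
      congr 1
      ring

/-! ### The theorem, by normalisation. -/

theorem mainTheorem5 (c E : ℝ) (hc : 0 < c) (hE : 0 < E) :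
    ∃ C : ℝ, 0 < C ∧
      ∀ (n q d m : ℕ) (X : Matrix (Fin n) (Fin q) ℝ) (Y : Matrix (Fin n) (Fin d) ℝ)
        (p : Fin n → ℝ) (ε : ℝ),
        (∀ i, 0 ≤ p i) → ∑ i, p i = 1 →
        (∀ i, (1 / 4) * ((rowNorm X i ^ 2 + ammWeight X Y * rowNorm Y i ^ 2) /
            (matFrobNorm X ^ 2 + ammWeight X Y * matFrobNorm Y ^ 2)) ≤ p i) →
        0 < ε → ε ≤ E →
        C * (ε⁻¹ ^ 2 * Real.log n * (stableRank X + stableRank Y)) ≤ m →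
        ∀ (Ω : Type*) [MeasurableSpace Ω] (μ : Measure Ω) [IsProbabilityMeasure μ]
          (ℓ : Fin m → Ω → Fin n),
          (∀ r, Measurable (ℓ r)) → iIndepFun ℓ μ →
          (∀ r i, μ.real {ω | ℓ r ω = i} = p i) →
          μ.real {ω | ε * matOpNorm X * matOpNorm Y <
              matOpNorm (X.transpose * (samplingMatrix p fun r => ℓ r ω).transpose *
                samplingMatrix p (fun r => ℓ r ω) * Y - X.transpose * Y)} ≤
            (n : ℝ) ^ (-c) := by
  refine ⟨(768 + 48 * E) * Real.exp (c + 1), by positivity, ?_⟩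
  intro n q d m X Y p ε hp hp1 hlow hε hεE hm Ω _ μ _ ℓ _ hind hlaw
  -- No distribution exists for `n = 0`, and for `n = 1` the claimed bound is 1. From `n = 2` on,
  -- `log n > 0` forces `m > 0`.
  rcases Nat.lt_or_ge n 2 with hn | hn
  · interval_cases n
    · simp at hp1
    · simp
  by_cases hX : X = 0
  · subst hX
    simp [matOpNorm_eq_zero.2, Real.rpow_nonneg]
  by_cases hY : Y = 0
  · subst hY
    simp [matOpNorm_eq_zero.2, Real.rpow_nonneg]
  have hX0 : 0 < matOpNorm X := (matOpNorm_nonneg X).lt_of_ne' (mt matOpNorm_eq_zero.1 hX)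
  have hY0 : 0 < matOpNorm Y := (matOpNorm_nonneg Y).lt_of_ne' (mt matOpNorm_eq_zero.1 hY)
  set a := matOpNorm X with ha
  set b := matOpNorm Y with hb
  have hXF := matFrobNorm_pos hX
  have hYF := matFrobNorm_pos hY
  have hs0 : 0 < stableRank X + stableRank Y := by
    rw [stableRank, stableRank, ← ha, ← hb]; positivity
  have hlog : 0 < Real.log n := Real.log_pos (by exact_mod_cast hn)
  have hm0 : 0 < m := by
    have h0 : (0 : ℝ) < m := lt_of_lt_of_le (by positivity) hm
    exact_mod_cast h0
  have hfl := Nat.ceil_lt_add_one hlog.le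
  have hce := Nat.le_ceil (Real.log n)
  -- The moment used is of order `2⌈log n⌉ = 2(j + 1)`.
  obtain ⟨j, hj⟩ : ∃ j, ⌈Real.log n⌉₊ = j + 1 := Nat.exists_eq_succ_of_ne_zero (Nat.ceil_pos.2 hlog).ne'
  rw [hj] at hfl hce
  push_cast at hfl hce
  have hX1 : matOpNorm (a⁻¹ • X) = 1 := by
    rw [matOpNorm_smul, ← ha, abs_of_pos (inv_pos.2 hX0), inv_mul_cancel₀ hX0.ne']
  have hY1 : matOpNorm (b⁻¹ • Y) = 1 := by
    rw [matOpNorm_smul, ← hb, abs_of_pos (inv_pos.2 hY0), inv_mul_cancel₀ hY0.ne']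
  have hs : matFrobNorm (a⁻¹ • X) ^ 2 + matFrobNorm (b⁻¹ • Y) ^ 2 =
      stableRank X + stableRank Y := by
    rw [matFrobNorm_smul_sq, matFrobNorm_smul_sq, stableRank, stableRank, ← ha, ← hb]
    field_simp
  -- Dividing numerator and denominator of the sampling bound by `a²` turns the weight `γ` into the
  -- separate normalisations of `X` and `Y`, and the denominator into the sum of stable ranks.
  have hps : ∀ i, rowNorm (a⁻¹ • X) i ^ 2 + rowNorm (b⁻¹ • Y) i ^ 2 ≤
      4 * (stableRank X + stableRank Y) * p i := by
    intro i
    have h := hlow i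
    have e : (rowNorm X i ^ 2 + ammWeight X Y * rowNorm Y i ^ 2) /
            (matFrobNorm X ^ 2 + ammWeight X Y * matFrobNorm Y ^ 2) =
        (rowNorm (a⁻¹ • X) i ^ 2 + rowNorm (b⁻¹ • Y) i ^ 2) / (stableRank X + stableRank Y) := by
      rw [← hs, rowNorm_smul_sq, rowNorm_smul_sq, matFrobNorm_smul_sq, matFrobNorm_smul_sq,
        ammWeight, ← ha, ← hb]
      field_simp
    rw [e, ← mul_div_assoc, div_le_iff₀ hs0] at h
    linarith
  have key := measureReal_matOpNorm_gram_sub_le hX1.le hY1.le hp hp1 hs hs0 hps hε hm0 hind hlaw j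
    rfl
  refine le_trans (le_of_eq ?_) (key.trans (mul_pow_le_rpow_neg hE hε hεE hs0 hn hm0 hm hc hce
    (by linarith) rfl))
  congr 1
  ext ω
  set Z := samplingMatrix p fun r => ℓ r ω
  have e : (a⁻¹ • X).transpose * Z.transpose * Z * (b⁻¹ • Y) - (a⁻¹ • X).transpose * (b⁻¹ • Y) =
      (a * b)⁻¹ • (X.transpose * Z.transpose * Z * Y - X.transpose * Y) := by
    simp only [transpose_smul, Matrix.smul_mul, Matrix.mul_smul, smul_smul, smul_sub, mul_inv]
    simp only [mul_comm]
  rw [Set.mem_ofPred_eq, Set.mem_ofPred_eq, e, matOpNorm_smul,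
    abs_of_pos (inv_pos.2 (mul_pos hX0 hY0)), ← div_eq_inv_mul, lt_div_iff₀ (mul_pos hX0 hY0),
    mul_assoc]
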